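/- All hyperplane arrangements are central: an arrangement $\mathcal A$ in a finite-dimensional vector space $V$ is a finite set of linear hyperplanes of $V$, and $\mathcal A$ is an $\ell$-arrangement if $\dim V=\ell$. Let $L(\mathcal A)$ be the set of all intersections of subsets of $\mathcal A$ (with $V$ as the empty intersection), ordered by reverse inclusion. For $X\in L(\mathcal A)$ the localization is $\mathcal A_X=\{H\in\mathcal A: X\subseteq H\}$, an arrangement in $V$, and the restriction is $\mathcal A^X=\{X\cap H: H\in\mathcal A\setminus\mathcal A_X\}$, an arrangement in $X$. Let $\chi(\mathcal A,t)=\sum_{X\in L(\mathcal A)}\mu(V,X)\,t^{\dim X}$, where $\mu$ is the Möbius function of $L(\mathcal A)$. An $\ell$-arrangement $\mathcal A$ is called divisionally free if $\ell\le 2$, or $\mathcal A=\emptyset$, or there are arrangements $\mathcal A=\mathcal A_\ell,\mathcal A_{\ell-1},\dots,\mathcal A_2$ such that for each $i=3,\dots,\ell$ there is $H_i\in\mathcal A_i$ with $\mathcal A_{i-1}=\mathcal A_i^{H_i}$ and $\chi(\mathcal A_{i-1},t)$ divides $\chi(\mathcal A_i,t)$ in $\mathbb Z[t]$. For $r\ge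 1$, a primitive $r$-th root of unity $\zeta\in\mathbb C$, $\ell\ge 2$ and $0\le k\le\ell$, let $\mathcal A^k_\ell(r)$ be the arrangement in $\mathbb C^\ell$ with defining polynomial $$x_1\cdots x_k\prod_{1\le i<j\le \ell,\ 0\le n<r}(x_i-\zeta^n x_j).$$ Let $r\ge 3$ and $\ell\ge 4$, let $\mathcal A=\mathcal A^1_\ell(r)$, and let $$X=\bigcap_{2\le i<j\le\ell,\ 0\le n<r}\ker(x_i-\zeta^n x_j).$$ Then $X\in L(\mathcal A)$, and: 1. $\mathcal A$ is divisionally free; 2. $\mathcal A_X$ is isomorphic to $\mathcal A^0_{\ell-1}(r)$ up to a trivial factor, that is, some linear isomorphism $\mathbb C^\ell\cong\mathbb C\oplus\mathbb C^{\ell-1}$ carries $\mathcal A_X$ to $\Phi_1\times\mathcal A^0_{\ell-1}(r)=\{\mathbb C\oplus H: H\in\mathcal A^0_{\ell-1}(r)\}$, where $\Phi_1$ is the empty arrangement in $\mathbb C$; 3. neither $\mathcal A^0_{\ell-1}(r)$ nor $\mathcal A_X$ is divisionally free. Hence the class of divisionally free arrangements (already over $\mathbb C$) is not closed under localization: it is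 not true that for every divisionally free arrangement $\mathcal A$ in a finite-dimensional complex vector space and every $X\in L(\mathcal A)$ the localization $\mathcal A_X$ is divisionally free. -/

import Mathlib

universe u

/-- A central hyperplane arrangement in the vector space `V`: a finite set of linear
hyperplanes, that is, of maximal proper subspaces of `V`. -/
@[ext]
structure HyperplaneArrangement (K : Type*) (V : Type*) [Field K] [AddCommGroup V]
    [Module K V] where
  hyperplanes : Set (Submodule K V)
  finite_hyperplanes : hyperplanes.Finite
  isCoatom_of_mem : ∀ H ∈ hyperplanes, IsCoatom H

namespace HyperplaneArrangement

/-- A hyperplane not containing the subspace `X` meets `X` in a hyperplane of `X`. -/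
theorem isCoatom_comap_subtype {K V : Type*} [Field K] [AddCommGroup V] [Module K V]
    {H : Submodule K V} (hH : IsCoatom H) (X : Submodule K V) (hX : ¬ X ≤ H) :
    IsCoatom (H.comap X.subtype) := by
  refine ⟨fun h => hX (Submodule.comap_subtype_eq_top.mp h), fun Y hY => ?_⟩
  obtain ⟨hle, hne⟩ := lt_iff_le_not_ge.mp hY
  obtain ⟨y, hyY, hyH⟩ := SetLike.not_le_iff_exists.mp hne
  have hyH' : (y : V) ∉ H := hyH
  have hsup : H ⊔ Submodule.span K {(y : V)} = ⊤ := by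
    apply hH.2
    refine lt_of_le_of_ne le_sup_left (fun h => hyH' ?_)
    rw [h]
    exact Submodule.mem_sup_right (Submodule.mem_span_singleton_self _)
  rw [eq_top_iff]
  intro x _
  have hx : (x : V) ∈ H ⊔ Submodule.span K {(y : V)} := by
    rw [hsup]
    trivial
  obtain ⟨h, hh, z, hz, hxz⟩ := Submodule.mem_sup.mp hx
  obtain ⟨c, rfl⟩ := Submodule.mem_span_singleton.mp hz
  have hmem : x - c • y ∈ Y := by
    apply hle
    change ((x - c • y : X) : V) ∈ H
    have : ((x - c • y : X) : V) = h := by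
      simp [← hxz]
    rw [this]
    exact hh
  have := Y.add_mem hmem (Y.smul_mem c hyY)
  simpa using this

/-- The kernel of a nonzero linear form is a hyperplane. -/
theorem isCoatom_ker {K V : Type*} [Field K] [AddCommGroup V] [Module K V]
    (f : V →ₗ[K] K) (v : V) (hv : f v ≠ 0) : IsCoatom (LinearMap.ker f) :=
  LinearMap.isCoatom_ker_of_surjective
    (LinearMap.surjective fun h => hv (by rw [h, LinearMap.zero_apply]))

section Basic

variable {K V W : Type*} [Field K] [AddCommGroup V] [Module K V] [AddCommGroup W] [Module K W]

/-- The lattice `L(A)`: all intersections of subsets of `A`; the empty intersection is `V`. -/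
def intersectionLattice (A : HyperplaneArrangement K V) : Set (Submodule K V) :=
  {X | ∃ S ⊆ A.hyperplanes, X = sInf S}

theorem finite_intersectionLattice (A : HyperplaneArrangement K V) :
    A.intersectionLattice.Finite :=
  (A.finite_hyperplanes.finite_subsets.image sInf).subset
    (by rintro X ⟨S, hS, rfl⟩; exact ⟨S, hS, rfl⟩)

theorem top_mem_intersectionLattice (A : HyperplaneArrangement K V) :
    ⊤ ∈ A.intersectionLattice :=
  ⟨∅, Set.empty_subset _, sInf_empty.symm⟩

/-- The localization `A_X = {H ∈ A | X ⊆ H}`, an arrangement in the same space `V`. -/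
def localization (A : HyperplaneArrangement K V) (X : Submodule K V) :
    HyperplaneArrangement K V where
  hyperplanes := {H | H ∈ A.hyperplanes ∧ X ≤ H}
  finite_hyperplanes := A.finite_hyperplanes.subset fun _ h => h.1
  isCoatom_of_mem H h := A.isCoatom_of_mem H h.1

/-- The restriction `A^X = {X ∩ H | H ∈ A, X ⊄ H}`, an arrangement in the space `X`. -/
def restriction (A : HyperplaneArrangement K V) (X : Submodule K V) :
    HyperplaneArrangement K X where
  hyperplanes := {Y | ∃ H ∈ A.hyperplanes, ¬ X ≤ H ∧ Y = H.comap X.subtype}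
  finite_hyperplanes :=
    (A.finite_hyperplanes.image fun H => H.comap X.subtype).subset
      (by rintro Y ⟨H, hH, _, rfl⟩; exact ⟨H, hH, rfl⟩)
  isCoatom_of_mem := by
    rintro Y ⟨H, hH, hX, rfl⟩
    exact isCoatom_comap_subtype (A.isCoatom_of_mem H hH) X hX

/-- The empty arrangement in `V`. -/
def empty (K V : Type*) [Field K] [AddCommGroup V] [Module K V] :
    HyperplaneArrangement K V where
  hyperplanes := ∅
  finite_hyperplanes := Set.finite_empty
  isCoatom_of_mem _ h := h.elim

/-- The product arrangement `{H ⊕ W | H ∈ A} ∪ {V ⊕ H | H ∈ B}` in `V ⊕ W`. -/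
def prod (A : HyperplaneArrangement K V) (B : HyperplaneArrangement K W) :
    HyperplaneArrangement K (V × W) where
  hyperplanes := (fun H : Submodule K V => H.comap (LinearMap.fst K V W)) '' A.hyperplanes ∪
    (fun H : Submodule K W => H.comap (LinearMap.snd K V W)) '' B.hyperplanes
  finite_hyperplanes := (A.finite_hyperplanes.image _).union (B.finite_hyperplanes.image _)
  isCoatom_of_mem := by
    rintro _ (⟨H, hH, rfl⟩ | ⟨H, hH, rfl⟩)
    · exact (Submodule.isCoatom_comap_iff LinearMap.fst_surjective).mpr (A.isCoatom_of_mem H hH)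
    · exact (Submodule.isCoatom_comap_iff LinearMap.snd_surjective).mpr (B.isCoatom_of_mem H hH)

/-- Two arrangements are (linearly) isomorphic if a linear isomorphism of the ambient spaces
carries the hyperplanes of the first bijectively to those of the second. -/
def IsIsomorphic (A : HyperplaneArrangement K V) (B : HyperplaneArrangement K W) : Prop :=
  ∃ e : V ≃ₗ[K] W,
    (fun H : Submodule K V => H.map (e : V →ₗ[K] W)) '' A.hyperplanes = B.hyperplanes

open Classical in
/-- The characteristic polynomial `χ(A, t) = ∑_{X ∈ L(A)} μ(X) t ^ dim X`. Here `L(A)` is ordered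
by reverse inclusion, so that `V` is its least element, and `μ(X) = μ(V, X)`. -/
noncomputable def charPoly (A : HyperplaneArrangement K V) : Polynomial ℤ :=
  letI : Fintype A.intersectionLattice := A.finite_intersectionLattice.fintype
  letI : LocallyFiniteOrder (A.intersectionLattice)ᵒᵈ := Fintype.toLocallyFiniteOrder
  ∑ X : A.intersectionLattice,
    Polynomial.C (IncidenceAlgebra.mu ℤ
        (OrderDual.toDual (⟨⊤, A.top_mem_intersectionLattice⟩ : A.intersectionLattice))
        (OrderDual.toDual X)) *
      Polynomial.X ^ Module.finrank K (X : Submodule K V)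

end Basic

/-- `A` is the first member of a sequence of `n` consecutive restrictions to hyperplanes
(a hyperplane `H` of the current arrangement `B` is chosen and `B` is replaced by `B^H`), in which
`χ(B^H, t)` divides `χ(B, t)` at each step and whose last member is a `2`-arrangement. -/
def HasDivisionalSequence {K : Type*} [Field K] :
    ℕ → ∀ {V : Type u} [AddCommGroup V] [Module K V], HyperplaneArrangement K V → Prop
  | 0, V, _, _, _ => Module.finrank K V = 2
  | n + 1, _, _, _, A => ∃ H ∈ A.hyperplanes,
      (A.restriction H).charPoly ∣ A.charPoly ∧ HasDivisionalSequence n (A.restriction H)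

/-- An arrangement `A` in the `ℓ`-dimensional space `V` is divisionally free if `ℓ ≤ 2`, or `A` is
empty, or there is a sequence of consecutive restrictions to hyperplanes from `A` to a
`2`-arrangement whose successive characteristic polynomials divide one another. -/
def IsDivisionallyFree {K : Type*} [Field K] {V : Type u} [AddCommGroup V] [Module K V]
    [FiniteDimensional K V] (A : HyperplaneArrangement K V) : Prop :=
  Module.finrank K V ≤ 2 ∨ A.hyperplanes = ∅ ∨ ∃ n : ℕ, HasDivisionalSequence n A

/-- The hyperplane `ker (x_i - ζ ^ n x_j)` of `ℂ^ℓ`. -/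
def diagonalHyperplane {ℓ : ℕ} (ζ : ℂ) (n : ℕ) (i j : Fin ℓ) : Submodule ℂ (Fin ℓ → ℂ) :=
  LinearMap.ker ((LinearMap.proj i : (Fin ℓ → ℂ) →ₗ[ℂ] ℂ) - ζ ^ n • LinearMap.proj j)

/-- The hyperplane `ker x_i` of `ℂ^ℓ`. -/
def coordinateHyperplane {ℓ : ℕ} (i : Fin ℓ) : Submodule ℂ (Fin ℓ → ℂ) :=
  LinearMap.ker (LinearMap.proj i : (Fin ℓ → ℂ) →ₗ[ℂ] ℂ)

/-- The arrangement `A^k_ℓ(r)` in `ℂ^ℓ`, with defining polynomial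
`x_1 ⋯ x_k ∏_{i < j, 0 ≤ n < r} (x_i - ζ ^ n x_j)`, where `ζ` is a primitive `r`-th root of unity.
The coordinates `x_1, …, x_ℓ` are indexed by `0, …, ℓ - 1` in `Fin ℓ`. -/
def monomialArrangement (ζ : ℂ) (r k ℓ : ℕ) : HyperplaneArrangement ℂ (Fin ℓ → ℂ) where
  hyperplanes := {H | ∃ i : Fin ℓ, (i : ℕ) < k ∧ H = coordinateHyperplane i} ∪
    {H | ∃ i j : Fin ℓ, i < j ∧ ∃ n < r, H = diagonalHyperplane ζ n i j}
  finite_hyperplanes := by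
    refine Set.Finite.union ?_ ?_
    · refine (Set.finite_range fun i : Fin ℓ => coordinateHyperplane i).subset ?_
      rintro H ⟨i, _, rfl⟩
      exact ⟨i, rfl⟩
    · refine (Set.finite_range fun p : Fin ℓ × Fin ℓ × Fin r =>
        diagonalHyperplane ζ (p.2.2 : ℕ) p.1 p.2.1).subset ?_
      rintro H ⟨i, j, _, n, hn, rfl⟩
      exact ⟨(i, j, ⟨n, hn⟩), rfl⟩
  isCoatom_of_mem := by
    rintro H (⟨i, _, rfl⟩ | ⟨i, j, hij, n, _, rfl⟩)
    · exact isCoatom_ker _ (Pi.single i 1) (by simp)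
    · exact isCoatom_ker _ (Pi.single i 1) (by simp [hij.ne'])

end HyperplaneArrangement

/-! Everything rests on the factorization of `charPoly_dowling_eq_mul`: χ(A^k_ℓ(r)) is the product
of the t - (jr + 1) for j < ℓ - 1, times t - ((ℓ - 1)r + 1 - (ℓ - k)). Restricting to a coordinate
hyperplane leaves the full arrangement A^{ℓ-1}_{ℓ-1}(r), whose polynomial is the first product. One
coordinate hyperplane therefore suffices to start a divisional sequence, and later steps again
restrict to coordinate hyperplanes. Without coordinate hyperplanes, every restriction of A^0_m(r) is
a copy of A^1_{m-1}(r). For m ≥ 3 and r ≥ 3 the last root of its polynomial is not cancelled in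
χ(A^0_m(r)), so no first step exists (`not_charPoly_restriction_dvd_dowling`). An empty
one-dimensional factor multiplies both polynomials by t and changes nothing, which settles the
localization.

The factorization comes from Whitney's theorem via deletion-restriction. The full arrangement is
built one coordinate at a time: the hyperplanes involving the new coordinate are graphs over the old
space that meet pairwise above old hyperplanes, so together they contribute one linear factor
(`charPoly_graphExtension`). Coordinate hyperplanes are then deleted singly. The computation uses
`dowling`, with an arbitrary finite index type and symmetric equations, so that restriction just
removes an index and no order has to be maintained. -/

namespace HyperplaneArrangement

/-! ### Whitney's theorem and deletion-restriction -/

section CharacteristicPolynomial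

variable {K V W : Type*} [Field K] [AddCommGroup V] [Module K V] [AddCommGroup W] [Module K W]

open Classical in
/-- **Whitney's theorem**: the characteristic polynomial as an alternating sum over the subsets
of a finite family, possibly with repetitions, that enumerates the arrangement. -/
theorem charPoly_eq_sum_powerset (A : HyperplaneArrangement K V) {ι : Type*} (s : Finset ι)
    (f : ι → Submodule K V) (hf : f '' s = A.hyperplanes) :
    A.charPoly = ∑ S ∈ s.powerset,
      Polynomial.C ((-1 : ℤ) ^ S.card) * Polynomial.X ^ Module.finrank K (S.inf f : Submodule K V)
    := by
  let _ : Fintype A.intersectionLattice := A.finite_intersectionLattice.fintype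
  let _ : LocallyFiniteOrder (A.intersectionLattice)ᵒᵈ := Fintype.toLocallyFiniteOrder
  have hL : ∀ S ∈ s.powerset, S.inf f ∈ A.intersectionLattice := by
    intro S hS
    refine ⟨f '' S, ?_, Finset.inf_eq_sInf_image S f⟩
    rw [← hf]
    exact Set.image_mono (by simpa using hS)
  have hle : ∀ X : A.intersectionLattice, X ≠ ⟨⊤, A.top_mem_intersectionLattice⟩ →
      ∃ i ∈ s, (X : Submodule K V) ≤ f i := by
    rintro ⟨X, S, hS, rfl⟩ hX
    obtain ⟨H, hH⟩ : S.Nonempty := by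
      by_contra h
      rw [Set.not_nonempty_iff_eq_empty] at h
      subst h
      simp at hX
    obtain ⟨i, hi, rfl⟩ := hf ▸ hS hH
    exact ⟨i, hi, sInf_le hH⟩
  -- Candidate for the Möbius function: the signed count of subfamilies whose intersection is
  -- exactly X.
  set ν : A.intersectionLattice → ℤ := fun X =>
    ∑ S ∈ s.powerset with S.inf f = (X : Submodule K V), (-1 : ℤ) ^ S.card with hν
  have hsum : ∀ X : A.intersectionLattice,
      ∑ Y with X ≤ Y, ν Y = if X = ⟨⊤, A.top_mem_intersectionLattice⟩ then 1 else 0 := by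
    intro X
    -- Summing over all Y ⊇ X collects every subfamily of the members containing X; these signs
    -- cancel unless no member contains X.
    have h1 : ∑ Y with X ≤ Y, ν Y =
        ∑ S ∈ (s.filter fun i => (X : Submodule K V) ≤ f i).powerset, (-1 : ℤ) ^ S.card := by
      simp only [hν, Finset.sum_filter]
      rw [← Finset.sum_filter, Finset.sum_comm]
      rw [← Finset.sum_subset (s₁ := (s.filter fun i => (X : Submodule K V) ≤ f i).powerset)
        (Finset.powerset_mono.mpr (Finset.filter_subset _ _))]
      · refine Finset.sum_congr rfl fun S hS => ?_
        have hS' : S ∈ s.powerset :=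
          Finset.powerset_mono.mpr (Finset.filter_subset _ _) hS
        rw [Finset.sum_eq_single ⟨S.inf f, hL S hS'⟩]
        · simp
        · rintro Y - hY
          rw [if_neg]
          rintro h
          exact hY (Subtype.ext h.symm)
        · intro h
          exfalso
          apply h
          simp only [Finset.mem_filter, Finset.mem_univ, true_and]
          change (X : Submodule K V) ≤ S.inf f
          refine Finset.le_inf fun i hi => ?_
          exact (Finset.mem_filter.mp (Finset.mem_powerset.mp hS hi)).2
      · intro S hS hS'
        refine Finset.sum_eq_zero fun Y hY => if_neg ?_
        intro h
        apply hS'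
        rw [Finset.mem_powerset] at hS ⊢
        intro i hi
        have hXY : (X : Submodule K V) ≤ Y := (Finset.mem_filter.mp hY).2
        exact Finset.mem_filter.mpr ⟨hS hi, hXY.trans (h ▸ Finset.inf_le hi)⟩
    rw [h1, Finset.sum_powerset_neg_one_pow_card]
    congr 1
    rw [eq_iff_iff]
    constructor
    · intro h
      by_contra hX
      obtain ⟨i, hi, hXi⟩ := hle X hX
      have : i ∈ s.filter fun i => (X : Submodule K V) ≤ f i := Finset.mem_filter.mpr ⟨hi, hXi⟩
      rw [h] at this
      simp at this
    · rintro rfl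
      refine Finset.filter_eq_empty_iff.mpr fun i hi h => ?_
      exact (A.isCoatom_of_mem (f i) (hf ▸ ⟨i, hi, rfl⟩)).1 (top_le_iff.mp h)
  have hmu : ∀ X : A.intersectionLattice, IncidenceAlgebra.mu ℤ
      (OrderDual.toDual (⟨⊤, A.top_mem_intersectionLattice⟩ : A.intersectionLattice))
        (OrderDual.toDual X) = ν X := by
    intro X
    -- Both functions satisfy the same recursion, which determines the value at X from the values at
    -- strictly larger subspaces.
    induction X using WellFoundedGT.induction with
    | ind X ih =>
      have h1 := IncidenceAlgebra.sum_Icc_mu_right (𝕜 := ℤ)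
        (OrderDual.toDual (⟨⊤, A.top_mem_intersectionLattice⟩ : A.intersectionLattice))
        (OrderDual.toDual X)
      have h2 := hsum X
      have h3 : ∀ g : A.intersectionLattice → ℤ, ∑ Y with X ≤ Y, g Y =
          g X + ∑ Y with X < Y, g Y := by
        intro g
        rw [← Finset.sum_insert (s := Finset.univ.filter fun Y => X < Y) (by simp)]
        refine Finset.sum_congr ?_ fun _ _ => rfl
        ext Y
        simp [le_iff_eq_or_lt, eq_comm]
      have h4 : ∑ x ∈ Finset.Icc
          (OrderDual.toDual (⟨⊤, A.top_mem_intersectionLattice⟩ : A.intersectionLattice))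
          (OrderDual.toDual X), IncidenceAlgebra.mu ℤ
            (OrderDual.toDual (⟨⊤, A.top_mem_intersectionLattice⟩ : A.intersectionLattice)) x =
          ∑ Y with X ≤ Y, IncidenceAlgebra.mu ℤ
            (OrderDual.toDual (⟨⊤, A.top_mem_intersectionLattice⟩ : A.intersectionLattice))
            (OrderDual.toDual Y) := by
        refine Finset.sum_bij (fun x _ => OrderDual.ofDual x) ?_ ?_ ?_ ?_
        · intro x hx
          exact Finset.mem_filter.mpr ⟨Finset.mem_univ _, (Finset.mem_Icc.mp hx).2⟩
        · intro x _ y _ h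
          exact h
        · intro Y hY
          refine ⟨OrderDual.toDual Y, Finset.mem_Icc.mpr ⟨?_, ?_⟩, rfl⟩
          · exact OrderDual.toDual_le_toDual.mpr (show (Y : Submodule K V) ≤ ⊤ from le_top)
          · simpa using hY
        · intro x _
          rfl
      rw [h4, h3, Finset.sum_congr rfl fun Y hY => ih Y (Finset.mem_filter.mp hY).2] at h1
      rw [h3] at h2
      have h5 : (if OrderDual.toDual (⟨⊤, A.top_mem_intersectionLattice⟩ : A.intersectionLattice) =
          OrderDual.toDual X then (1 : ℤ) else 0) =
          if X = ⟨⊤, A.top_mem_intersectionLattice⟩ then 1 else 0 := by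
        simp only [OrderDual.toDual_inj, eq_comm]
      linarith
  have h0 : A.charPoly = ∑ X : A.intersectionLattice,
      Polynomial.C (ν X) * Polynomial.X ^ Module.finrank K (X : Submodule K V) := by
    rw [charPoly]
    exact Finset.sum_congr rfl fun X _ => by rw [hmu X]
  rw [h0]
  simp only [hν, map_sum, Finset.sum_mul, Finset.sum_filter]
  rw [Finset.sum_comm]
  refine Finset.sum_congr rfl fun S hS => ?_
  rw [Finset.sum_eq_single ⟨S.inf f, hL S hS⟩]
  · simp
  · rintro Y - hY
    rw [if_neg]
    · simp
    rintro h
    exact hY (Subtype.ext h.symm)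
  · simp

/-- Arrangements indexed by families whose intersections have equal dimensions have the same
characteristic polynomial, up to a shift of all dimensions. -/
theorem charPoly_eq_X_pow_mul (A : HyperplaneArrangement K V) (B : HyperplaneArrangement K W)
    (g : Submodule K V → Submodule K W) (hg : g '' A.hyperplanes = B.hyperplanes) (d : ℕ)
    (h : ∀ S : Finset (Submodule K V), Module.finrank K (S.inf g : Submodule K W) =
      d + Module.finrank K (S.inf id : Submodule K V)) :
    B.charPoly = Polynomial.X ^ d * A.charPoly := by
  rw [A.charPoly_eq_sum_powerset A.finite_hyperplanes.toFinset id (by simp),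
    B.charPoly_eq_sum_powerset A.finite_hyperplanes.toFinset g (by simpa using hg),
    Finset.mul_sum]
  refine Finset.sum_congr rfl fun S _ => ?_
  rw [h, pow_add]
  ring

theorem charPoly_eq_of_isIsomorphic {A : HyperplaneArrangement K V}
    {B : HyperplaneArrangement K W} (h : A.IsIsomorphic B) : A.charPoly = B.charPoly := by
  obtain ⟨e, he⟩ := h
  rw [charPoly_eq_X_pow_mul A B _ he 0, pow_zero, one_mul]
  intro S
  rw [zero_add, ← LinearEquiv.finrank_map_eq e]
  -- Preimages, unlike images in general, commute with finite intersections.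
  have h : (fun H : Submodule K V => H.map (e : V →ₗ[K] W)) =
      fun H => H.comap (e.symm : W →ₗ[K] V) :=
    funext fun H => Submodule.map_equiv_eq_comap_symm e H
  rw [h, Submodule.map_equiv_eq_comap_symm e]
  rw [Submodule.comap_finsetInf (e.symm : W →ₗ[K] V) S id]
  rfl

/-- The preimage of `Y` under the second projection is the product of the first factor with `Y`. -/
def comapSndEquiv (W : Type*) [AddCommGroup W] [Module K W] (Y : Submodule K V) :
    Y.comap (LinearMap.snd K W V) ≃ₗ[K] W × Y where
  toFun x := (x.1.1, ⟨x.1.2, x.2⟩)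
  invFun x := ⟨(x.1, x.2), x.2.2⟩
  map_add' _ _ := rfl
  map_smul' _ _ := rfl
  left_inv _ := rfl
  right_inv _ := rfl

theorem charPoly_empty_prod [FiniteDimensional K V] (A : HyperplaneArrangement K V) :
    ((empty K K).prod A).charPoly = Polynomial.X * A.charPoly := by
  rw [charPoly_eq_X_pow_mul A _ (fun H => H.comap (LinearMap.snd K K V)) (by simp [prod, empty]) 1,
    pow_one]
  intro S
  have h : S.inf (fun H : Submodule K V => H.comap (LinearMap.snd K K V)) =
      (S.inf id).comap (LinearMap.snd K K V) :=
    (Submodule.comap_finsetInf (LinearMap.snd K K V) S id).symm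
  rw [h, (comapSndEquiv K (S.inf id)).finrank_eq]
  simp

/-- **Deletion-restriction.** -/
theorem charPoly_eq_charPoly_sub (A B : HyperplaneArrangement K V) (H : Submodule K V)
    (hH : H ∉ B.hyperplanes) (hA : A.hyperplanes = insert H B.hyperplanes) :
    A.charPoly = B.charPoly - (A.restriction H).charPoly := by
  classical
  have hHA : H ∈ A.hyperplanes := hA ▸ Set.mem_insert _ _
  -- Subsets containing H give, with the sign reversed, the sum for the restriction. Different
  -- members of B may have the same trace on H, hence the need for families with repetitions.
  rw [A.charPoly_eq_sum_powerset (insert H B.finite_hyperplanes.toFinset) id (by simp [hA]),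
    B.charPoly_eq_sum_powerset B.finite_hyperplanes.toFinset id (by simp),
    (A.restriction H).charPoly_eq_sum_powerset B.finite_hyperplanes.toFinset
      (fun Y => Y.comap H.subtype), Finset.sum_powerset_insert (by simpa using hH),
    sub_eq_add_neg, ← Finset.sum_neg_distrib]
  · congr 1
    refine Finset.sum_congr rfl fun S hS => ?_
    have hHS : H ∉ S := fun h => hH (by simpa using Finset.mem_powerset.mp hS h)
    rw [Finset.card_insert_of_notMem hHS, Finset.inf_insert, pow_succ]
    have : S.inf (fun Y : Submodule K V => Y.comap H.subtype) = (S.inf id).comap H.subtype := by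
      rw [Submodule.comap_finsetInf]
      rfl
    have h : (S.inf id).comap H.subtype = (H ⊓ S.inf id).comap H.subtype := by simp
    rw [this, h, (Submodule.comapSubtypeEquivOfLe inf_le_left).finrank_eq]
    simp
  · ext Y
    simp only [restriction, Set.mem_image, Set.mem_ofPred_eq, Set.Finite.coe_toFinset]
    constructor
    · rintro ⟨H', hH', rfl⟩
      have hH'A : H' ∈ A.hyperplanes := hA ▸ Set.mem_insert_of_mem _ hH'
      refine ⟨H', hH'A, fun h => hH ?_, rfl⟩
      rcases h.eq_or_lt with h | h
      · exact h ▸ hH'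
      · exact absurd ((A.isCoatom_of_mem H hHA).2 _ h) (A.isCoatom_of_mem H' hH'A).1
    · rintro ⟨H', hH', hle, rfl⟩
      rw [hA] at hH'
      rcases hH' with rfl | hH'
      · exact absurd le_rfl hle
      · exact ⟨H', hH', rfl⟩

end CharacteristicPolynomial

end HyperplaneArrangement

namespace HyperplaneArrangement

/-! ### Isomorphisms and restrictions -/

section Isomorphism

variable {K V W : Type*} [Field K] [AddCommGroup V] [Module K V] [AddCommGroup W] [Module K W]

theorem isIsomorphic_of_image_comap {A : HyperplaneArrangement K V}
    {B : HyperplaneArrangement K W} (e : V ≃ₗ[K] W)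
    (h : (fun H : Submodule K W => H.comap (e : V →ₗ[K] W)) '' B.hyperplanes = A.hyperplanes) :
    A.IsIsomorphic B := by
  refine ⟨e, ?_⟩
  rw [← h, Set.image_image]
  convert Set.image_id _ using 2
  ext1 H
  exact Submodule.map_comap_eq_of_surjective e.surjective H

theorem IsIsomorphic.symm {A : HyperplaneArrangement K V} {B : HyperplaneArrangement K W}
    (h : A.IsIsomorphic B) : B.IsIsomorphic A := by
  obtain ⟨e, he⟩ := h
  refine isIsomorphic_of_image_comap e.symm ?_
  rw [← he]
  exact Set.image_congr fun H _ => (Submodule.map_equiv_eq_comap_symm e H).symm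

/-- The restriction to the range `X` of an injective linear map is obtained by pulling back the
hyperplanes that do not contain `X`. -/
theorem restriction_isIsomorphic (A : HyperplaneArrangement K V) (X : Submodule K V)
    (B : HyperplaneArrangement K W) (f : W →ₗ[K] V) (hf : Function.Injective f)
    (hX : LinearMap.range f = X)
    (hB : ∀ Y ∈ B.hyperplanes, ∃ H ∈ A.hyperplanes, H.comap f = Y)
    (hA : ∀ H ∈ A.hyperplanes, H.comap f = ⊤ ∨ H.comap f ∈ B.hyperplanes) :
    (A.restriction X).IsIsomorphic B := by
  subst hX
  refine (isIsomorphic_of_image_comap (LinearEquiv.ofInjective f hf) ?_).symm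
  have key : ∀ H : Submodule K V, (H.comap (LinearMap.range f).subtype).comap
      (LinearEquiv.ofInjective f hf : W →ₗ[K] LinearMap.range f) = H.comap f := fun H => rfl
  have htop : ∀ H : Submodule K V, LinearMap.range f ≤ H ↔ H.comap f = ⊤ := fun H => by
    rw [LinearMap.range_le_iff_comap]
  ext Y
  simp only [restriction, Set.mem_image, Set.mem_ofPred_eq]
  constructor
  · rintro ⟨_, ⟨H, hH, hle, rfl⟩, rfl⟩
    rw [key]
    exact (hA H hH).resolve_left fun h => hle ((htop H).mpr h)
  · intro hY
    obtain ⟨H, hH, rfl⟩ := hB Y hY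
    exact ⟨_, ⟨H, hH, fun h => (B.isCoatom_of_mem _ hY).1 ((htop H).mp h), rfl⟩, key H⟩

theorem IsIsomorphic.restriction {A : HyperplaneArrangement K V}
    {B : HyperplaneArrangement K W} {e : V ≃ₗ[K] W}
    (he : (fun H : Submodule K V => H.map (e : V →ₗ[K] W)) '' A.hyperplanes = B.hyperplanes)
    (X : Submodule K V) :
    (B.restriction (X.map (e : V →ₗ[K] W))).IsIsomorphic (A.restriction X) := by
  have key : ∀ H : Submodule K V, (H.map (e : V →ₗ[K] W)).comap ((e : V →ₗ[K] W) ∘ₗ X.subtype) =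
      H.comap X.subtype := fun H => by
    rw [Submodule.comap_comp, Submodule.comap_map_eq_of_injective e.injective]
  refine restriction_isIsomorphic _ _ _ ((e : V →ₗ[K] W) ∘ₗ X.subtype)
    (e.injective.comp X.injective_subtype) ?_ ?_ ?_
  · rw [LinearMap.range_comp, Submodule.range_subtype]
  · rintro _ ⟨H, hH, _, rfl⟩
    exact ⟨_, he ▸ ⟨H, hH, rfl⟩, key H⟩
  · rw [← he]
    rintro _ ⟨H, hH, rfl⟩
    rw [key]
    by_cases h : X ≤ H
    · exact Or.inl (Submodule.comap_subtype_eq_top.mpr h)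
    · exact Or.inr ⟨H, hH, h, rfl⟩

theorem restriction_empty_prod_isIsomorphic (A : HyperplaneArrangement K V) (H : Submodule K V) :
    (((empty K K).prod A).restriction (H.comap (LinearMap.snd K K V))).IsIsomorphic
      ((empty K K).prod (A.restriction H)) := by
  refine restriction_isIsomorphic _ _ _
    (LinearMap.prodMap (LinearMap.id : K →ₗ[K] K) H.subtype) ?_ ?_ ?_ ?_
  · rintro ⟨a, x⟩ ⟨b, y⟩ h
    simpa using h
  · ext ⟨a, x⟩
    simp
  · rintro _ (⟨_, h, _⟩ | ⟨_, ⟨H', hH', _, rfl⟩, rfl⟩)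
    · exact h.elim
    · exact ⟨_, Or.inr ⟨H', hH', rfl⟩, rfl⟩
  · rintro _ (⟨_, h, _⟩ | ⟨H', hH', rfl⟩)
    · exact h.elim
    · by_cases h : H ≤ H'
      · refine Or.inl (eq_top_iff.mpr ?_)
        rintro ⟨a, x⟩ -
        exact h x.2
      · exact Or.inr (Or.inr ⟨_, ⟨H', hH', h, rfl⟩, rfl⟩)

end Isomorphism

/-! ### Invariance of divisional sequences and an obstruction -/

section DivisionalFreeness

variable {K : Type*} [Field K]

/-- Successive restrictions live on nested subspaces; this lets each be replaced by a model on a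
coordinate space. -/
theorem HasDivisionalSequence.of_isIsomorphic {n : ℕ} {V W : Type u} [AddCommGroup V] [Module K V]
    [AddCommGroup W] [Module K W] {A : HyperplaneArrangement K V} {B : HyperplaneArrangement K W}
    (hA : HasDivisionalSequence n A) (h : A.IsIsomorphic B) : HasDivisionalSequence n B := by
  induction n generalizing V W with
  | zero =>
    obtain ⟨e, -⟩ := h
    exact e.finrank_eq.symm.trans hA
  | succ n ih =>
    obtain ⟨H, hH, hdvd, hseq⟩ := hA
    have h0 := h
    obtain ⟨e, he⟩ := h
    have hr := (IsIsomorphic.restriction he H).symm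
    refine ⟨H.map (e : V →ₗ[K] W), he ▸ ⟨H, hH, rfl⟩, ?_, ih hseq hr⟩
    rwa [← charPoly_eq_of_isIsomorphic hr, ← charPoly_eq_of_isIsomorphic h0]

/-- An arrangement in dimension at least `3` none of whose restrictions to hyperplanes has a
characteristic polynomial dividing that of the arrangement is not divisionally free. -/
theorem not_isDivisionallyFree {V : Type u} [AddCommGroup V] [Module K V] [FiniteDimensional K V]
    (A : HyperplaneArrangement K V) (hV : 2 < Module.finrank K V) (hne : A.hyperplanes.Nonempty)
    (h : ∀ H ∈ A.hyperplanes, ¬ (A.restriction H).charPoly ∣ A.charPoly) :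
    ¬ A.IsDivisionallyFree := by
  rintro (h2 | h0 | ⟨n, hn⟩)
  · omega
  · exact hne.ne_empty h0
  · cases n with
    | zero => exact hV.ne' hn
    | succ n =>
      obtain ⟨H, hH, hdvd, -⟩ := hn
      exact h H hH hdvd

end DivisionalFreeness

/-! ### Adding graphs of linear forms -/

section GraphExtension

variable {K V : Type*} [Field K] [AddCommGroup V] [Module K V]

/-- The arrangement in `K × V` consisting of the hyperplanes `K × H` with `H ∈ A` and the graphs
of the linear forms in `Φ`. -/
noncomputable def graphExtension (A : HyperplaneArrangement K V) (Φ : Finset (V →ₗ[K] K)) :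
    HyperplaneArrangement K (K × V) where
  hyperplanes := ((empty K K).prod A).hyperplanes ∪
    {H | ∃ φ ∈ Φ, H = LinearMap.ker (LinearMap.fst K K V - φ ∘ₗ LinearMap.snd K K V)}
  finite_hyperplanes := by
    refine ((empty K K).prod A).finite_hyperplanes.union ?_
    refine (Φ.finite_toSet.image fun φ =>
      LinearMap.ker (LinearMap.fst K K V - φ ∘ₗ LinearMap.snd K K V)).subset ?_
    rintro _ ⟨φ, hφ, rfl⟩
    exact ⟨φ, hφ, rfl⟩
  isCoatom_of_mem := by
    rintro _ (h | ⟨φ, -, rfl⟩)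
    · exact isCoatom_of_mem _ _ h
    · exact isCoatom_ker _ (1, 0) (by simp)

/-- If the graphs of the linear forms in `Φ` meet pairwise in hyperplanes of `A`, then adding
them multiplies the characteristic polynomial by a linear factor. -/
theorem charPoly_graphExtension [FiniteDimensional K V] (A : HyperplaneArrangement K V)
    (Φ : Finset (V →ₗ[K] K))
    (hΦ : ∀ φ ∈ Φ, ∀ ψ ∈ Φ, φ ≠ ψ → LinearMap.ker (φ - ψ) ∈ A.hyperplanes) :
    (A.graphExtension Φ).charPoly = (Polynomial.X - Polynomial.C (Φ.card : ℤ)) * A.charPoly := by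
  classical
  induction Φ using Finset.induction_on with
  | empty =>
    have : A.graphExtension ∅ = (empty K K).prod A := by
      ext H
      simp [graphExtension]
    rw [this, charPoly_empty_prod]
    simp
  | insert φ Φ hφ ih =>
    have hinj : ∀ ψ, LinearMap.ker (LinearMap.fst K K V - φ ∘ₗ LinearMap.snd K K V) =
        LinearMap.ker (LinearMap.fst K K V - ψ ∘ₗ LinearMap.snd K K V) → φ = ψ := by
      intro ψ h
      ext x
      have hx : (φ x, x) ∈ LinearMap.ker (LinearMap.fst K K V - φ ∘ₗ LinearMap.snd K K V) := by
        simp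
      rw [h] at hx
      simpa [sub_eq_zero] using hx
    -- On the graph of φ, parametrized by x ↦ (φ x, x), another graph ψ cuts out ker (φ - ψ),
    -- already in A. Each added graph thus subtracts one copy of χ(A).
    have hiso : ((A.graphExtension (insert φ Φ)).restriction
        (LinearMap.ker (LinearMap.fst K K V - φ ∘ₗ LinearMap.snd K K V))).IsIsomorphic A := by
      refine restriction_isIsomorphic _ _ _ (LinearMap.prod φ LinearMap.id) ?_ ?_ ?_ ?_
      · intro x y h
        exact congrArg Prod.snd h
      · ext ⟨a, x⟩
        constructor
        · rintro ⟨y, hy⟩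
          obtain ⟨rfl, rfl⟩ := Prod.ext_iff.mp hy
          simp
        · intro h
          exact ⟨x, Prod.ext (sub_eq_zero.mp h).symm rfl⟩
      · intro Y hY
        exact ⟨_, Or.inl (Or.inr ⟨Y, hY, rfl⟩), rfl⟩
      · rintro _ ((⟨_, h, _⟩ | ⟨Y, hY, rfl⟩) | ⟨ψ, hψ, rfl⟩)
        · exact h.elim
        · exact Or.inr hY
        · by_cases h : φ = ψ
          · subst h
            left
            ext x
            simp
          · exact Or.inr (hΦ φ (Finset.mem_insert_self _ _) ψ hψ h)
    rw [charPoly_eq_charPoly_sub (A.graphExtension (insert φ Φ)) (A.graphExtension Φ)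
      (LinearMap.ker (LinearMap.fst K K V - φ ∘ₗ LinearMap.snd K K V)), ih,
      charPoly_eq_of_isIsomorphic hiso, Finset.card_insert_of_notMem hφ]
    · push_cast
      simp only [map_add, map_one]
      ring
    · intro ψ hψ χ hχ
      exact hΦ ψ (Finset.mem_insert_of_mem hψ) χ (Finset.mem_insert_of_mem hχ)
    · rintro ((⟨_, h, _⟩ | ⟨Y, hY, h⟩) | ⟨ψ, hψ, h⟩)
      · exact h.elim
      -- The vector (1, 0) lies in every K × Y but in no graph.
      · have : ((1 : K), (0 : V)) ∈ Y.comap (LinearMap.snd K K V) := by simp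
        rw [show Y.comap (LinearMap.snd K K V) = _ from h] at this
        simp at this
      · exact hφ (hinj ψ h ▸ hψ)
    · ext H
      simp only [graphExtension, Finset.mem_insert, Set.mem_union, Set.mem_ofPred_eq,
        Set.mem_insert_iff, exists_eq_or_imp]
      tauto

end GraphExtension

end HyperplaneArrangement

namespace HyperplaneArrangement

/-! ### Dowling arrangements: restrictions and characteristic polynomials -/

section Dowling

variable {K : Type*} [Field K]

/-- The arrangement in `K^σ` of the hyperplanes `x_i = 0` for `i ∈ C` and `g x_i = h x_j` for
`i ≠ j` and `g`, `h` in the finite group `G` of units. -/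
def dowling (G : Subgroup Kˣ) [Finite G] (σ : Type*) [Finite σ] (C : Set σ) :
    HyperplaneArrangement K (σ → K) where
  hyperplanes := {H | ∃ i ∈ C, H = LinearMap.ker (LinearMap.proj i : (σ → K) →ₗ[K] K)} ∪
    {H | ∃ i j : σ, i ≠ j ∧ ∃ g ∈ G, ∃ h ∈ G, H = LinearMap.ker
      ((g : K) • LinearMap.proj i - (h : K) • LinearMap.proj j : (σ → K) →ₗ[K] K)}
  finite_hyperplanes := by
    refine Set.Finite.union ?_ ?_
    · refine (Set.finite_range fun i : σ =>
        LinearMap.ker (LinearMap.proj i : (σ → K) →ₗ[K] K)).subset ?_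
      rintro H ⟨i, _, rfl⟩
      exact ⟨i, rfl⟩
    · refine (Set.finite_range fun p : σ × σ × G × G => LinearMap.ker
        (((p.2.2.1 : Kˣ) : K) • LinearMap.proj p.1 - ((p.2.2.2 : Kˣ) : K) • LinearMap.proj p.2.1 :
          (σ → K) →ₗ[K] K)).subset ?_
      rintro H ⟨i, j, _, g, hg, h, hh, rfl⟩
      exact ⟨(i, j, ⟨g, hg⟩, ⟨h, hh⟩), rfl⟩
  isCoatom_of_mem := by
    classical
    rintro H (⟨i, _, rfl⟩ | ⟨i, j, hij, g, _, h, _, rfl⟩)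
    · exact isCoatom_ker _ (Pi.single i 1) (by simp)
    · exact isCoatom_ker _ (Pi.single i 1) (by simp [hij.symm])

theorem ker_sub_comm {V : Type*} [AddCommGroup V] [Module K V] (f g : V →ₗ[K] K) :
    LinearMap.ker (f - g) = LinearMap.ker (g - f) := by
  ext x
  simp only [LinearMap.mem_ker, LinearMap.sub_apply, sub_eq_zero]
  exact eq_comm

theorem ker_units_smul_sub {V : Type*} [AddCommGroup V] [Module K V] (g h : Kˣ)
    (f f' : V →ₗ[K] K) :
    LinearMap.ker ((g : K) • f - (h : K) • f') =
      LinearMap.ker (f - ((g⁻¹ * h : Kˣ) : K) • f') := by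
  rw [← LinearMap.ker_smul (f - ((g⁻¹ * h : Kˣ) : K) • f') (g : K) g.ne_zero, smul_sub, smul_smul]
  simp

variable {σ : Type*}

open Classical in
/-- The linear map `K^{σ ∖ {i}} → K^σ` which inserts the value of `φ` as the coordinate `x_i`. -/
noncomputable def insertCoordinate (i : σ) (φ : ({a // a ≠ i} → K) →ₗ[K] K) :
    ({a // a ≠ i} → K) →ₗ[K] (σ → K) :=
  LinearMap.pi fun a => if h : a = i then φ else LinearMap.proj ⟨a, h⟩

theorem proj_comp_insertCoordinate_self (i : σ) (φ : ({a // a ≠ i} → K) →ₗ[K] K) :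
    LinearMap.proj i ∘ₗ insertCoordinate i φ = φ := by
  rw [insertCoordinate, LinearMap.proj_pi, dif_pos rfl]

theorem proj_comp_insertCoordinate_of_ne (i : σ) (φ : ({a // a ≠ i} → K) →ₗ[K] K) (a : σ)
    (ha : a ≠ i) : LinearMap.proj a ∘ₗ insertCoordinate i φ = LinearMap.proj ⟨a, ha⟩ := by
  rw [insertCoordinate, LinearMap.proj_pi, dif_neg ha]

theorem insertCoordinate_injective (i : σ) (φ : ({a // a ≠ i} → K) →ₗ[K] K) :
    Function.Injective (insertCoordinate i φ) := by
  intro x y h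
  ext ⟨a, ha⟩
  have := congrArg (LinearMap.proj a : (σ → K) →ₗ[K] K) h
  rw [← LinearMap.comp_apply, ← LinearMap.comp_apply,
    proj_comp_insertCoordinate_of_ne i φ a ha] at this
  exact this

theorem mem_range_insertCoordinate (i : σ) (φ : ({a // a ≠ i} → K) →ₗ[K] K) (x : σ → K) :
    x ∈ LinearMap.range (insertCoordinate i φ) ↔ x i = φ fun a => x a := by
  constructor
  · rintro ⟨y, rfl⟩
    have h : (fun a : {a // a ≠ i} => insertCoordinate i φ y a) = y := funext fun a =>
      LinearMap.congr_fun (proj_comp_insertCoordinate_of_ne i φ a a.2) y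
    rw [h]
    exact LinearMap.congr_fun (proj_comp_insertCoordinate_self i φ) y
  · intro h
    refine ⟨fun a => x a, funext fun a => ?_⟩
    by_cases ha : a = i
    · subst ha
      rw [h]
      exact LinearMap.congr_fun (proj_comp_insertCoordinate_self a φ) _
    · exact LinearMap.congr_fun (proj_comp_insertCoordinate_of_ne i φ a ha) _

variable (G : Subgroup Kˣ)

open Classical in
/-- Splitting off the coordinate `x_i`. -/
noncomputable def splitCoordinate (K : Type*) [Field K] (i : σ) :
    (σ → K) ≃ₗ[K] K × ({a // a ≠ i} → K) :=
  { Equiv.funSplitAt i K with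
    map_add' := fun _ _ => rfl
    map_smul' := fun _ _ => rfl }

/-- The linear forms `0` and `g x_j`. -/
def monomialForm (G : Subgroup Kˣ) (τ : Type*) : Option (G × τ) → ((τ → K) →ₗ[K] K)
  | none => 0
  | some p => ((p.1 : Kˣ) : K) • LinearMap.proj p.2

theorem monomialForm_injective (τ : Type*) :
    Function.Injective (monomialForm G τ) := by
  classical
  rintro (_ | ⟨g, a⟩) (_ | ⟨h, b⟩) e
  · rfl
  · have := LinearMap.congr_fun e (Pi.single b 1)
    exact absurd this.symm (by simp [monomialForm])
  · have := LinearMap.congr_fun e (Pi.single a 1)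
    exact absurd this (by simp [monomialForm])
  · have := LinearMap.congr_fun e (Pi.single a 1)
    by_cases hab : a = b
    · subst hab
      have hgh : g = h := Subtype.ext (Units.ext (by simpa [monomialForm] using this))
      rw [hgh]
    · simp [monomialForm, Ne.symm hab] at this

variable [Finite σ] [Finite G]

/-- The restriction to a coordinate hyperplane. -/
theorem dowling_restriction_coordinate (C : Set σ) (i : σ) :
    ((dowling G σ C).restriction
      (LinearMap.ker (LinearMap.proj i : (σ → K) →ₗ[K] K))).IsIsomorphic
      (dowling G {a // a ≠ i} Set.univ) := by
  have hs := proj_comp_insertCoordinate_self (K := K) i 0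
  have hne := proj_comp_insertCoordinate_of_ne (K := K) i 0
  -- On x_i = 0 the equation g x_i = h x_b becomes x_b = 0, so all remaining coordinate hyperplanes
  -- appear, whatever C is.
  have haux : ∀ b ≠ i, ∀ g ∈ G, ∀ h ∈ G,
      (LinearMap.ker ((g : K) • LinearMap.proj i - (h : K) • LinearMap.proj b :
        (σ → K) →ₗ[K] K)).comap (insertCoordinate i 0) ∈
        (dowling G {a // a ≠ i} Set.univ).hyperplanes := by
    intro b hb g _ h _
    refine Or.inl ⟨⟨b, hb⟩, Set.mem_univ _, ?_⟩
    rw [← LinearMap.ker_comp, LinearMap.sub_comp, LinearMap.smul_comp, LinearMap.smul_comp, hs,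
      hne b hb, ker_sub_comm, smul_zero, sub_zero, LinearMap.ker_smul _ _ h.ne_zero]
  refine restriction_isIsomorphic _ _ _ (insertCoordinate i 0)
    (insertCoordinate_injective i 0) ?_ ?_ ?_
  · ext x
    rw [mem_range_insertCoordinate]
    simp
  · rintro _ (⟨⟨a, ha⟩, -, rfl⟩ | ⟨⟨a, ha⟩, ⟨b, hb⟩, hab, g, hg, h, hh, rfl⟩)
    · refine ⟨_, Or.inr ⟨a, i, ha, 1, G.one_mem, 1, G.one_mem, rfl⟩, ?_⟩
      rw [← LinearMap.ker_comp, LinearMap.sub_comp, LinearMap.smul_comp, LinearMap.smul_comp, hs,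
        hne a ha]
      simp
    · refine ⟨_, Or.inr ⟨a, b, fun e => hab (Subtype.ext e), g, hg, h, hh, rfl⟩, ?_⟩
      rw [← LinearMap.ker_comp, LinearMap.sub_comp, LinearMap.smul_comp, LinearMap.smul_comp,
        hne a ha, hne b hb]
  · rintro _ (⟨a, -, rfl⟩ | ⟨a, b, hab, g, hg, h, hh, rfl⟩)
    · rw [← LinearMap.ker_comp]
      by_cases ha : a = i
      · subst ha
        rw [hs]
        exact Or.inl LinearMap.ker_zero
      · rw [hne a ha]
        exact Or.inr (Or.inl ⟨_, Set.mem_univ _, rfl⟩)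
    · right
      by_cases ha : a = i
      · subst ha
        exact haux b hab.symm g hg h hh
      · by_cases hb : b = i
        · subst hb
          rw [ker_sub_comm]
          exact haux a ha h hh g hg
        · rw [← LinearMap.ker_comp, LinearMap.sub_comp, LinearMap.smul_comp, LinearMap.smul_comp,
            hne a ha, hne b hb]
          exact Or.inr ⟨_, _, fun e => hab (congrArg Subtype.val e), g, hg, h, hh, rfl⟩

/-- The restriction of the arrangement without coordinate hyperplanes to one of its members. -/
theorem dowling_restriction_diagonal [Nontrivial G] {i j : σ} (hij : i ≠ j) {g h : Kˣ}
    (hg : g ∈ G) (hh : h ∈ G) :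
    ((dowling G σ ∅).restriction (LinearMap.ker
      ((g : K) • LinearMap.proj i - (h : K) • LinearMap.proj j : (σ → K) →ₗ[K] K))).IsIsomorphic
      (dowling G {a // a ≠ i} {⟨j, hij.symm⟩}) := by
  set u : Kˣ := g⁻¹ * h with hu
  have huG : u ∈ G := G.mul_mem (G.inv_mem hg) hh
  set φ : ({a // a ≠ i} → K) →ₗ[K] K := (u : K) • LinearMap.proj ⟨j, hij.symm⟩ with hφ
  have hs := proj_comp_insertCoordinate_self i φ
  have hne := proj_comp_insertCoordinate_of_ne i φ
  have haux : ∀ b ≠ i, ∀ g ∈ G, ∀ h ∈ G,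
      (LinearMap.ker ((g : K) • LinearMap.proj i - (h : K) • LinearMap.proj b :
        (σ → K) →ₗ[K] K)).comap (insertCoordinate i φ) = ⊤ ∨
      (LinearMap.ker ((g : K) • LinearMap.proj i - (h : K) • LinearMap.proj b :
        (σ → K) →ₗ[K] K)).comap (insertCoordinate i φ) ∈
        (dowling G {a // a ≠ i} {⟨j, hij.symm⟩}).hyperplanes := by
    intro b hb g hg h hh
    rw [← LinearMap.ker_comp, LinearMap.sub_comp, LinearMap.smul_comp, LinearMap.smul_comp, hs,
      hne b hb, hφ, smul_smul]
    by_cases hbj : b = j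
    · subst hbj
      rw [← sub_smul]
      by_cases h0 : (g : K) * u - h = 0
      · rw [h0, zero_smul]
        exact Or.inl LinearMap.ker_zero
      · rw [LinearMap.ker_smul _ _ h0]
        exact Or.inr (Or.inl ⟨_, rfl, rfl⟩)
    · exact Or.inr (Or.inr ⟨⟨j, hij.symm⟩, ⟨b, hb⟩, fun e => hbj (congrArg Subtype.val e).symm,
        g * u, G.mul_mem hg huG, h, hh, by simp⟩)
  refine restriction_isIsomorphic _ _ _ (insertCoordinate i φ)
    (insertCoordinate_injective i φ) ?_ ?_ ?_
  · ext x
    rw [mem_range_insertCoordinate, ker_units_smul_sub, ← hu, hφ]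
    simp [sub_eq_zero]
  · rintro _ (⟨_, rfl, rfl⟩ | ⟨⟨a, ha⟩, ⟨b, hb⟩, hab, g, hg, h, hh, rfl⟩)
    -- The hyperplane x_j = 0 arises from x_i = v x_j with v ≠ u, since x_i = u x_j here; this needs
    -- G nontrivial.
    · obtain ⟨⟨v, hv⟩, hvu⟩ := exists_ne (⟨u, huG⟩ : G)
      refine ⟨_, Or.inr ⟨i, j, hij, 1, G.one_mem, v, hv, rfl⟩, ?_⟩
      rw [← LinearMap.ker_comp, LinearMap.sub_comp, LinearMap.smul_comp, LinearMap.smul_comp, hs,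
        hne j hij.symm, hφ, smul_smul, ← sub_smul, LinearMap.ker_smul]
      intro h0
      apply hvu
      rw [Units.val_one, one_mul, sub_eq_zero] at h0
      exact Subtype.ext (Units.ext h0.symm)
    · refine ⟨_, Or.inr ⟨a, b, fun e => hab (Subtype.ext e), g, hg, h, hh, rfl⟩, ?_⟩
      rw [← LinearMap.ker_comp, LinearMap.sub_comp, LinearMap.smul_comp, LinearMap.smul_comp,
        hne a ha, hne b hb]
  · rintro _ (⟨a, ⟨⟩, -⟩ | ⟨a, b, hab, g, hg, h, hh, rfl⟩)
    by_cases ha : a = i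
    · subst ha
      exact haux b hab.symm g hg h hh
    · by_cases hb : b = i
      · subst hb
        rw [ker_sub_comm]
        exact haux a ha h hh g hg
      · rw [← LinearMap.ker_comp, LinearMap.sub_comp, LinearMap.smul_comp, LinearMap.smul_comp,
          hne a ha, hne b hb]
        exact Or.inr (Or.inr ⟨_, _, fun e => hab (congrArg Subtype.val e), g, hg, h, hh, rfl⟩)

/-- The hyperplanes involving x_i are the graphs x_i = 0 and, after division by a unit, x_i = g x_j;
all others are cylinders over the remaining coordinates. -/
theorem dowling_univ_isIsomorphic_graphExtension (i : σ) :
    (dowling G σ Set.univ).IsIsomorphic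
      ((dowling G {a // a ≠ i} Set.univ).graphExtension
        (Set.finite_range (monomialForm G {a // a ≠ i})).toFinset) := by
  have hzero : LinearMap.ker (LinearMap.proj i - monomialForm G {a // a ≠ i} none ∘ₗ
      LinearMap.funLeft K K Subtype.val) = LinearMap.ker (LinearMap.proj i : (σ → K) →ₗ[K] K) := by
    rw [monomialForm, LinearMap.zero_comp, sub_zero]
  have haux : ∀ b ≠ i, ∀ g ∈ G, ∀ h ∈ G,
      LinearMap.ker ((g : K) • LinearMap.proj i - (h : K) • LinearMap.proj b :
        (σ → K) →ₗ[K] K) ∈ (fun H : Submodule K (K × ({a // a ≠ i} → K)) =>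
        H.comap (splitCoordinate K i : (σ → K) →ₗ[K] K × ({a // a ≠ i} → K))) ''
        ((dowling G {a // a ≠ i} Set.univ).graphExtension
          (Set.finite_range (monomialForm G {a // a ≠ i})).toFinset).hyperplanes := by
    intro b hb g hg h hh
    refine ⟨_, Or.inr ⟨monomialForm G {a // a ≠ i}
      (some (⟨g⁻¹ * h, G.mul_mem (G.inv_mem hg) hh⟩, ⟨b, hb⟩)), by simp, rfl⟩, ?_⟩
    rw [ker_units_smul_sub]
    rfl
  refine isIsomorphic_of_image_comap (splitCoordinate K i) ?_
  ext H
  constructor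
  · rintro ⟨_, (⟨_, h, _⟩ | ⟨_, ⟨a, -, rfl⟩ | ⟨a, b, hab, g, hg, h, hh, rfl⟩, rfl⟩) |
      ⟨φ, hφ, rfl⟩, rfl⟩
    · exact h.elim
    · exact Or.inl ⟨a, Set.mem_univ _, rfl⟩
    · exact Or.inr ⟨a, b, fun e => hab (Subtype.ext e), g, hg, h, hh, rfl⟩
    · rw [Set.Finite.mem_toFinset] at hφ
      obtain ⟨_ | ⟨g, b⟩, rfl⟩ := hφ
      · exact Or.inl ⟨i, Set.mem_univ _, hzero⟩
      · refine Or.inr ⟨i, b, b.2.symm, 1, G.one_mem, g, g.2, ?_⟩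
        rw [Units.val_one, one_smul]
        rfl
  · rintro (⟨a, -, rfl⟩ | ⟨a, b, hab, g, hg, h, hh, rfl⟩)
    · by_cases ha : a = i
      · subst ha
        exact ⟨_, Or.inr ⟨monomialForm G _ none, by simp, rfl⟩, hzero⟩
      · exact ⟨_, Or.inl (Or.inr ⟨_, Or.inl ⟨⟨a, ha⟩, Set.mem_univ _, rfl⟩, rfl⟩), rfl⟩
    · by_cases ha : a = i
      · subst ha
        exact haux b hab.symm g hg h hh
      · by_cases hb : b = i
        · subst hb
          rw [ker_sub_comm]
          exact haux a ha h hh g hg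
        · exact ⟨_, Or.inl (Or.inr ⟨_, Or.inr ⟨⟨a, ha⟩, ⟨b, hb⟩,
            fun e => hab (congrArg Subtype.val e), g, hg, h, hh, rfl⟩, rfl⟩), rfl⟩

/-- This supplies the hypothesis of `charPoly_graphExtension`. Two multiples of the same x_a agree
exactly on x_a = 0, so all coordinate hyperplanes must be present. -/
theorem ker_monomialForm_sub_mem {φ ψ : (σ → K) →ₗ[K] K}
    (hφ : φ ∈ Set.range (monomialForm G σ)) (hψ : ψ ∈ Set.range (monomialForm G σ))
    (hne : φ ≠ ψ) : LinearMap.ker (φ - ψ) ∈ (dowling G σ Set.univ).hyperplanes := by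
  obtain ⟨_ | ⟨g, a⟩, rfl⟩ := hφ <;> obtain ⟨_ | ⟨h, b⟩, rfl⟩ := hψ
  · exact absurd rfl hne
  · rw [ker_sub_comm, monomialForm, monomialForm, sub_zero, LinearMap.ker_smul _ _ h.1.ne_zero]
    exact Or.inl ⟨b, Set.mem_univ _, rfl⟩
  · rw [monomialForm, monomialForm, sub_zero, LinearMap.ker_smul _ _ g.1.ne_zero]
    exact Or.inl ⟨a, Set.mem_univ _, rfl⟩
  · by_cases hab : a = b
    · subst hab
      have hgh : ((g : Kˣ) : K) - ((h : Kˣ) : K) ≠ 0 := fun h0 =>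
        hne (by rw [Subtype.ext (Units.ext (sub_eq_zero.mp h0))])
      have hsub : monomialForm G σ (some (g, a)) - monomialForm G σ (some (h, a)) =
          (((g : Kˣ) : K) - ((h : Kˣ) : K)) • (LinearMap.proj a : (σ → K) →ₗ[K] K) :=
        (sub_smul _ _ (LinearMap.proj a : (σ → K) →ₗ[K] K)).symm
      rw [hsub, LinearMap.ker_smul _ _ hgh]
      exact Or.inl ⟨a, Set.mem_univ _, rfl⟩
    · exact Or.inr ⟨a, b, hab, g, g.2, h, h.2, rfl⟩

/-- The polynomial `∏_{k < n} (t - (k r + 1))`. -/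
noncomputable def monomialPoly (r n : ℕ) : Polynomial ℤ :=
  ∏ k ∈ Finset.range n, (Polynomial.X - Polynomial.C ((k : ℤ) * r + 1))

theorem monomialPoly_succ (r n : ℕ) : monomialPoly r (n + 1) =
    monomialPoly r n * (Polynomial.X - Polynomial.C ((n : ℤ) * r + 1)) :=
  Finset.prod_range_succ _ _

theorem monomialPoly_ne_zero (r n : ℕ) : monomialPoly r n ≠ 0 :=
  (Polynomial.monic_prod_of_monic _ _ fun _ _ => Polynomial.monic_X_sub_C _).ne_zero

theorem card_ne_add_one (i : σ) : Nat.card {a // a ≠ i} + 1 = Nat.card σ := by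
  classical
  rw [← Finite.card_option, Nat.card_congr (Equiv.optionSubtypeNe i)]

theorem charPoly_dowling_univ :
    (dowling G σ Set.univ).charPoly = monomialPoly (Nat.card G) (Nat.card σ) := by
  induction hn : Nat.card σ generalizing σ with
  | zero =>
    have : IsEmpty σ := (Nat.card_eq_zero.mp hn).resolve_right fun h => h.not_finite ‹_›
    rw [charPoly_eq_sum_powerset _ ∅ id]
    · have h : Module.finrank K ((∅ : Finset (Submodule K (σ → K))).inf id : Submodule K (σ → K)) =
          0 := Module.finrank_zero_of_subsingleton
      simp [monomialPoly, h]
    · ext H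
      simp [dowling]
  | succ n ih =>
    have hne : Nonempty σ := (Nat.card_pos_iff.mp (hn ▸ n.succ_pos)).1
    obtain ⟨i⟩ := hne
    have hi := card_ne_add_one i
    -- The zero form accounts for the 1, the forms g x_j for n |G|.
    have hcard : (Set.finite_range (monomialForm G {a // a ≠ i})).toFinset.card =
        n * Nat.card G + 1 := by
      rw [← Set.ncard_eq_toFinset_card _ (Set.finite_range _), ← Nat.card_coe_set_eq,
        Nat.card_range_of_injective (monomialForm_injective G _), Finite.card_option,
        Nat.card_prod, mul_comm]
      congr 2
      omega
    rw [charPoly_eq_of_isIsomorphic (dowling_univ_isIsomorphic_graphExtension G i),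
      charPoly_graphExtension, ih (by omega), hcard, monomialPoly_succ, mul_comm]
    · push_cast
      rfl
    · intro φ hφ ψ hψ hne
      rw [Set.Finite.mem_toFinset] at hφ hψ
      exact ker_monomialForm_sub_mem G hφ hψ hne

theorem ker_proj_notMem_dowling {C : Set σ} {i : σ} (hi : i ∉ C) :
    LinearMap.ker (LinearMap.proj i : (σ → K) →ₗ[K] K) ∉ (dowling G σ C).hyperplanes := by
  classical
  rintro (⟨j, hj, h⟩ | ⟨a, b, hab, g, -, h, -, e⟩)
  · have hij : i ≠ j := fun e => hi (e ▸ hj)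
    have : Pi.single j (1 : K) ∈ LinearMap.ker (LinearMap.proj i : (σ → K) →ₗ[K] K) := by
      simp [hij]
    rw [h] at this
    simp at this
  · by_cases ha : a = i
    · subst ha
      have : Pi.single b (1 : K) ∈ LinearMap.ker (LinearMap.proj a : (σ → K) →ₗ[K] K) := by
        simp [hab]
      rw [e] at this
      simp [hab] at this
    · have : Pi.single a (1 : K) ∈ LinearMap.ker (LinearMap.proj i : (σ → K) →ₗ[K] K) := by
        simp [Ne.symm ha]
      rw [e] at this
      simp [hab.symm] at this

/-- Induction on the number of missing coordinate hyperplanes: each deletion adds the polynomial of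
the full arrangement in one coordinate fewer. The truncated subtraction is harmless, since for empty
σ the coefficient vanishes. -/
theorem charPoly_dowling (C : Set σ) : (dowling G σ C).charPoly =
    monomialPoly (Nat.card G) (Nat.card σ) +
      Polynomial.C (Cᶜ.ncard : ℤ) * monomialPoly (Nat.card G) (Nat.card σ - 1) := by
  induction hn : Cᶜ.ncard generalizing C with
  | zero =>
    have : C = Set.univ := by
      rwa [Set.ncard_eq_zero, Set.compl_empty_iff] at hn
    rw [this, charPoly_dowling_univ]
    simp
  | succ n ih =>
    obtain ⟨i, hi⟩ : Cᶜ.Nonempty := Set.nonempty_of_ncard_ne_zero (by omega)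
    have hc : (insert i C)ᶜ.ncard = n := by
      have h : (insert i C)ᶜ = Cᶜ \ {i} := by
        ext a
        simp [and_comm]
      rw [h, Set.ncard_sdiff_singleton_of_mem hi, hn, Nat.add_sub_cancel]
    have hdel := charPoly_eq_charPoly_sub (dowling G σ (insert i C)) (dowling G σ C)
      (LinearMap.ker (LinearMap.proj i : (σ → K) →ₗ[K] K)) (ker_proj_notMem_dowling G hi) (by
        ext H
        simp only [dowling, Set.mem_insert_iff, Set.mem_union, Set.mem_ofPred_eq, or_and_right,
          exists_or, exists_eq_left, or_assoc])
    have hcard := card_ne_add_one i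
    rw [ih _ hc, charPoly_eq_of_isIsomorphic (dowling_restriction_coordinate G (insert i C) i),
      charPoly_dowling_univ, show Nat.card {a // a ≠ i} = Nat.card σ - 1 by omega] at hdel
    rw [eq_sub_iff_add_eq] at hdel
    rw [← hdel]
    push_cast
    simp only [map_add, map_one]
    ring

/-- The characteristic polynomial in factored form. -/
theorem charPoly_dowling_eq_mul (C : Set σ) {n : ℕ} (hn : Nat.card σ = n + 1) :
    (dowling G σ C).charPoly = monomialPoly (Nat.card G) n *
      (Polynomial.X - Polynomial.C ((n : ℤ) * Nat.card G + 1 - Cᶜ.ncard)) := by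
  rw [charPoly_dowling, hn, Nat.add_sub_cancel, monomialPoly_succ]
  simp only [map_sub, map_add]
  ring

end Dowling

end HyperplaneArrangement

namespace HyperplaneArrangement

/-! ### Divisional freeness and its failure -/

section DowlingFreeness

theorem HasDivisionalSequence.dowling_succ {K σ : Type u} [Field K] [Finite σ] (G : Subgroup Kˣ)
    [Finite G] {C : Set σ} {i : σ} (hi : i ∈ C) {n : ℕ}
    (h : HasDivisionalSequence n (dowling G {a // a ≠ i} Set.univ)) :
    HasDivisionalSequence (n + 1) (dowling G σ C) := by
  have hiso := dowling_restriction_coordinate G C i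
  refine ⟨_, Or.inl ⟨i, hi, rfl⟩, ?_, h.of_isIsomorphic hiso.symm⟩
  rw [charPoly_eq_of_isIsomorphic hiso, charPoly_dowling_univ,
    charPoly_dowling_eq_mul G C (card_ne_add_one i).symm]
  exact dvd_mul_right _ _

theorem hasDivisionalSequence_dowling_univ {K : Type u} [Field K] (G : Subgroup Kˣ) [Finite G]
    (n : ℕ) (σ : Type u) [Finite σ] (hσ : Nat.card σ = n + 2) :
    HasDivisionalSequence n (dowling G σ Set.univ) := by
  induction n generalizing σ with
  | zero =>
    have := Fintype.ofFinite σ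
    rw [Nat.card_eq_fintype_card] at hσ
    exact (Module.finrank_fintype_fun_eq_card K).trans hσ
  | succ n ih =>
    obtain ⟨i⟩ := (Nat.card_pos_iff.mp (show 0 < Nat.card σ by omega)).1
    have := card_ne_add_one i
    exact (ih {a // a ≠ i} (by omega)).dowling_succ G (Set.mem_univ i)

theorem isDivisionallyFree_dowling {K σ : Type u} [Field K] [Finite σ] (G : Subgroup Kˣ)
    [Finite G] {C : Set σ} (hC : C.Nonempty) : (dowling G σ C).IsDivisionallyFree := by
  obtain ⟨i, hi⟩ := hC
  by_cases h : Nat.card σ ≤ 2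
  · left
    have := Fintype.ofFinite σ
    rwa [Module.finrank_fintype_fun_eq_card, ← Nat.card_eq_fintype_card]
  · have := card_ne_add_one i
    exact Or.inr (Or.inr ⟨_, (hasDivisionalSequence_dowling_univ G (Nat.card σ - 3) {a // a ≠ i}
      (by omega)).dowling_succ G hi⟩)

variable {K V W : Type*} [Field K] [AddCommGroup V] [Module K V] [AddCommGroup W] [Module K W]

theorem not_charPoly_restriction_dvd_dowling {σ : Type*} [Finite σ] (G : Subgroup Kˣ) [Finite G]
    (hσ : 3 ≤ Nat.card σ) (hG : 3 ≤ Nat.card G) :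
    ∀ H ∈ (dowling G σ ∅).hyperplanes,
      ¬ ((dowling G σ ∅).restriction H).charPoly ∣ (dowling G σ ∅).charPoly := by
  rintro _ (⟨_, ⟨⟩, -⟩ | ⟨i, j, hij, g, hg, h, hh, rfl⟩) hdvd
  have : Nontrivial G := Finite.one_lt_card_iff_nontrivial.mp (by omega)
  obtain ⟨n, hn⟩ := Nat.exists_eq_add_of_le' (show 2 ≤ Nat.card σ by omega)
  have hcard := card_ne_add_one i
  have hj : ({⟨j, hij.symm⟩}ᶜ : Set {a // a ≠ i}).ncard = n := by
    rw [Set.ncard_compl, Set.ncard_singleton]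
    omega
  have hempty : ((∅ : Set σ)ᶜ).ncard = n + 2 := by
    rw [Set.compl_empty, Set.ncard_univ, hn]
  rw [charPoly_eq_of_isIsomorphic (dowling_restriction_diagonal G hij hg hh),
    charPoly_dowling_eq_mul G _ (n := n) (by omega), charPoly_dowling_eq_mul G _ (n := n + 1) hn,
    monomialPoly_succ, mul_assoc, mul_dvd_mul_iff_left (monomialPoly_ne_zero _ _), hj, hempty,
    Polynomial.dvd_iff_isRoot] at hdvd
  simp only [Polynomial.IsRoot.def, Polynomial.eval_mul, Polynomial.eval_sub, Polynomial.eval_X,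
    Polynomial.eval_C, mul_eq_zero] at hdvd
  push_cast at hdvd
  have hG' : (3 : ℤ) ≤ Nat.card G := by exact_mod_cast hG
  rcases hdvd with h | h
  · have : (n : ℤ) = 0 := by linarith
    omega
  · have : (Nat.card G : ℤ) = 2 := by linarith
    omega

theorem not_charPoly_restriction_dvd_of_isIsomorphic {A : HyperplaneArrangement K V}
    {B : HyperplaneArrangement K W} (h : A.IsIsomorphic B)
    (hB : ∀ H ∈ B.hyperplanes, ¬ (B.restriction H).charPoly ∣ B.charPoly) :
    ∀ H ∈ A.hyperplanes, ¬ (A.restriction H).charPoly ∣ A.charPoly := by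
  have hc := charPoly_eq_of_isIsomorphic h
  obtain ⟨e, he⟩ := h
  intro H hH
  rw [hc, ← charPoly_eq_of_isIsomorphic (IsIsomorphic.restriction he H)]
  exact hB _ (he ▸ ⟨H, hH, rfl⟩)

theorem not_charPoly_restriction_dvd_empty_prod [FiniteDimensional K V]
    {A : HyperplaneArrangement K V}
    (hA : ∀ H ∈ A.hyperplanes, ¬ (A.restriction H).charPoly ∣ A.charPoly) :
    ∀ H ∈ ((empty K K).prod A).hyperplanes,
      ¬ (((empty K K).prod A).restriction H).charPoly ∣ ((empty K K).prod A).charPoly := by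
  rintro _ (⟨_, h, _⟩ | ⟨H, hH, rfl⟩)
  · exact h.elim
  · rw [charPoly_eq_of_isIsomorphic (restriction_empty_prod_isIsomorphic A H),
      charPoly_empty_prod, charPoly_empty_prod, mul_dvd_mul_iff_left Polynomial.X_ne_zero]
    exact hA H hH

end DowlingFreeness

section Monomial

theorem monomialArrangement_eq_dowling {ζ : ℂ} {r : ℕ} [NeZero r] (hζ : IsPrimitiveRoot ζ r)
    (k ℓ : ℕ) : monomialArrangement ζ r k ℓ =
      dowling (rootsOfUnity r ℂ) (Fin ℓ) {i | (i : ℕ) < k} := by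
  have haux : ∀ i j : Fin ℓ, i < j → ∀ g ∈ rootsOfUnity r ℂ, ∀ h ∈ rootsOfUnity r ℂ,
      LinearMap.ker ((g : ℂ) • LinearMap.proj i - (h : ℂ) • LinearMap.proj j :
        (Fin ℓ → ℂ) →ₗ[ℂ] ℂ) ∈ (monomialArrangement ζ r k ℓ).hyperplanes := by
    intro i j hij g hg h hh
    have hgh := (rootsOfUnity r ℂ).mul_mem ((rootsOfUnity r ℂ).inv_mem hg) hh
    obtain ⟨n, hn, he⟩ := hζ.eq_pow_of_pow_eq_one ((mem_rootsOfUnity' r _).mp hgh)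
    refine Or.inr ⟨i, j, hij, n, hn, ?_⟩
    rw [ker_units_smul_sub, ← he, diagonalHyperplane]
  ext H
  constructor
  · rintro (⟨i, hi, rfl⟩ | ⟨i, j, hij, n, -, rfl⟩)
    · exact Or.inl ⟨i, hi, rfl⟩
    · refine Or.inr ⟨i, j, hij.ne, 1, one_mem _, hζ.toRootsOfUnity ^ n, ?_, ?_⟩
      · exact Subgroup.pow_mem _ (SetLike.coe_mem _) n
      · rw [diagonalHyperplane]
        simp
  · rintro (⟨i, hi, rfl⟩ | ⟨i, j, hij, g, hg, h, hh, rfl⟩)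
    · exact Or.inl ⟨i, hi, rfl⟩
    · rcases hij.lt_or_gt with hij | hij
      · exact haux i j hij g hg h hh
      · rw [ker_sub_comm]
        exact haux j i hij h hh g hg

/-- Splitting off the first coordinate. -/
def splitFirst (m : ℕ) : (Fin (m + 1) → ℂ) ≃ₗ[ℂ] ℂ × (Fin m → ℂ) where
  toFun x := (x 0, fun i => x i.succ)
  invFun p := Fin.cons p.1 p.2
  map_add' _ _ := rfl
  map_smul' _ _ := rfl
  left_inv x := by
    ext i
    refine Fin.cases ?_ (fun i => ?_) i <;> simp
  right_inv p := by simp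

theorem localization_isIsomorphic_empty_prod (ζ : ℂ) (r m : ℕ) :
    ((monomialArrangement ζ r 1 (m + 1)).localization
      (sInf {H | ∃ i j : Fin (m + 1), 1 ≤ (i : ℕ) ∧ i < j ∧
        ∃ n < r, H = diagonalHyperplane ζ n i j})).IsIsomorphic
      ((empty ℂ ℂ).prod (monomialArrangement ζ r 0 m)) := by
  have hX : (Pi.single 0 1 : Fin (m + 1) → ℂ) ∈ sInf {H | ∃ i j : Fin (m + 1), 1 ≤ (i : ℕ) ∧
      i < j ∧ ∃ n < r, H = diagonalHyperplane ζ n i j} := by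
    rw [Submodule.mem_sInf]
    rintro _ ⟨i, j, hi, hij, n, -, rfl⟩
    have hi0 : i ≠ 0 := fun h => by simp [h] at hi
    have hj0 : j ≠ 0 := (i.zero_le.trans_lt hij).ne'
    simp [diagonalHyperplane, hi0, hj0]
  refine isIsomorphic_of_image_comap (splitFirst m) ?_
  ext H
  constructor
  · rintro ⟨_, ⟨_, h, _⟩ | ⟨_, ⟨i, hi, -⟩ | ⟨i, j, hij, n, hn, rfl⟩, rfl⟩, rfl⟩
    · exact h.elim
    · exact absurd hi (Nat.not_lt_zero _)
    · exact ⟨Or.inr ⟨i.succ, j.succ, Fin.succ_lt_succ_iff.mpr hij, n, hn, rfl⟩,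
        sInf_le ⟨i.succ, j.succ, by simp, Fin.succ_lt_succ_iff.mpr hij, n, hn, rfl⟩⟩
  · rintro ⟨⟨i, hi, rfl⟩ | ⟨i, j, hij, n, hn, rfl⟩, hle⟩
    · have hi0 : i = 0 := Fin.ext (by simpa using hi)
      subst hi0
      have := hle hX
      simp [coordinateHyperplane] at this
    · have hj0 : j ≠ 0 := (i.zero_le.trans_lt hij).ne'
      have hi0 : i ≠ 0 := by
        rintro rfl
        have := hle hX
        simp [diagonalHyperplane, hj0] at this
      obtain ⟨i, rfl⟩ := Fin.exists_succ_eq.mpr hi0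
      obtain ⟨j, rfl⟩ := Fin.exists_succ_eq.mpr hj0
      exact ⟨_, Or.inr ⟨_, Or.inr ⟨i, j, Fin.succ_lt_succ_iff.mp hij, n, hn, rfl⟩, rfl⟩, rfl⟩

end Monomial

end HyperplaneArrangement

open HyperplaneArrangement in
theorem monomialArrangement_localization_not_isDivisionallyFree (r ℓ : ℕ) (hr : 3 ≤ r)
    (hℓ : 4 ≤ ℓ) (ζ : ℂ) (hζ : IsPrimitiveRoot ζ r)
    (A : HyperplaneArrangement ℂ (Fin ℓ → ℂ)) (X : Submodule ℂ (Fin ℓ → ℂ))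
    (hA : A = monomialArrangement ζ r 1 ℓ)
    (hX : X = sInf {H | ∃ i j : Fin ℓ, 1 ≤ (i : ℕ) ∧ i < j ∧
      ∃ n < r, H = diagonalHyperplane ζ n i j}) :
    X ∈ A.intersectionLattice ∧ A.IsDivisionallyFree ∧
      (A.localization X).IsIsomorphic ((empty ℂ ℂ).prod (monomialArrangement ζ r 0 (ℓ - 1))) ∧
      ¬ (monomialArrangement ζ r 0 (ℓ - 1)).IsDivisionallyFree ∧
      ¬ (A.localization X).IsDivisionallyFree := by
  obtain ⟨m, rfl⟩ : ∃ m, ℓ = m + 1 := ⟨ℓ - 1, by omega⟩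
  rw [Nat.add_sub_cancel]
  subst hA hX
  have : NeZero r := ⟨by omega⟩
  have hiso := localization_isIsomorphic_empty_prod ζ r m
  have hnot : ∀ H ∈ (monomialArrangement ζ r 0 m).hyperplanes,
      ¬ ((monomialArrangement ζ r 0 m).restriction H).charPoly ∣
        (monomialArrangement ζ r 0 m).charPoly := by
    have h0 : {i : Fin m | (i : ℕ) < 0} = ∅ := by simp
    rw [monomialArrangement_eq_dowling hζ, h0]
    refine not_charPoly_restriction_dvd_dowling _ ?_ ?_
    · rw [Nat.card_fin]
      omega
    · rwa [hζ.card_rootsOfUnity]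
  have hmem : diagonalHyperplane ζ 0 (⟨0, by omega⟩ : Fin m) ⟨1, by omega⟩ ∈
      (monomialArrangement ζ r 0 m).hyperplanes :=
    Or.inr ⟨_, _, Fin.mk_lt_mk.mpr Nat.zero_lt_one, 0, by omega, rfl⟩
  refine ⟨⟨_, ?_, rfl⟩, ?_, hiso, not_isDivisionallyFree _ ?_ ⟨_, hmem⟩ hnot,
    not_isDivisionallyFree _ ?_ ?_ (not_charPoly_restriction_dvd_of_isIsomorphic hiso
      (not_charPoly_restriction_dvd_empty_prod hnot))⟩
  · rintro _ ⟨i, j, -, hij, n, hn, rfl⟩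
    exact Or.inr ⟨i, j, hij, n, hn, rfl⟩
  · rw [monomialArrangement_eq_dowling hζ]
    exact isDivisionallyFree_dowling _ ⟨0, by simp⟩
  · rw [Module.finrank_fin_fun]
    omega
  · rw [Module.finrank_fin_fun]
    omega
  · obtain ⟨e, he⟩ := hiso
    rw [← Set.image_nonempty, he]
    exact ⟨_, Or.inr ⟨_, hmem, rfl⟩⟩

theorem mainTheorem8 :
    (∀ (r ℓ : ℕ), 3 ≤ r → 4 ≤ ℓ → ∀ ζ : ℂ, IsPrimitiveRoot ζ r →
      ∀ (A : HyperplaneArrangement ℂ (Fin ℓ → ℂ)) (X : Submodule ℂ (Fin ℓ → ℂ)),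
        A = HyperplaneArrangement.monomialArrangement ζ r 1 ℓ →
        X = sInf {H | ∃ i j : Fin ℓ, 1 ≤ (i : ℕ) ∧ i < j ∧
          ∃ n < r, H = HyperplaneArrangement.diagonalHyperplane ζ n i j} →
        X ∈ A.intersectionLattice ∧
        A.IsDivisionallyFree ∧
        (A.localization X).IsIsomorphic
          ((HyperplaneArrangement.empty ℂ ℂ).prod
            (HyperplaneArrangement.monomialArrangement ζ r 0 (ℓ - 1))) ∧
        ¬ (HyperplaneArrangement.monomialArrangement ζ r 0 (ℓ - 1)).IsDivisionallyFree ∧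
        ¬ (A.localization X).IsDivisionallyFree) ∧
    ¬ (∀ (V : Type) [AddCommGroup V] [Module ℂ V] [FiniteDimensional ℂ V]
        (A : HyperplaneArrangement ℂ V), A.IsDivisionallyFree →
        ∀ X ∈ A.intersectionLattice, (A.localization X).IsDivisionallyFree) := by
  refine ⟨monomialArrangement_localization_not_isDivisionallyFree, fun h => ?_⟩
  obtain ⟨hX, hA, -, -, hn⟩ := monomialArrangement_localization_not_isDivisionallyFree 3 4 le_rfl
    le_rfl _ (Complex.isPrimitiveRoot_exp 3 (by norm_num)) _ _ rfl rfl
  exact hn (h _ _ hA _ hX)
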